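/- Let $\mathbb F$ be a non-Archimedean local field with residue characteristic $p$, let $\mathcal G$ be a connected reductive linear algebraic group defined over $\mathbb F$, and $G=\mathcal G(\mathbb F)$ with its locally compact topology. Let $P,\bar P$ be opposite parabolic subgroups defined over $\mathbb F$ with common Levi subgroup $M=P\cap\bar P$ and unipotent radicals $U,\bar U$; we write the same letters for their groups of $\mathbb F$-rational points. Let $R$ be a unital ring in which $p$ is invertible and let $(\pi,V)$ be a smooth representation of $G$ on an $R$-module. For a pro-$p$ subgroup $H\subseteq G$ let $\pi(e_H)\colon V\to V$ be integration over $H$ with respect to normalised Haar measure, and for $g\in G$ put $\pi(e_{HgH})=\pi(e_H)\pi(g)\pi(e_H)$. For a subgroup $H\subseteq G$ let $V^H$ be the submodule of $H$-invariants and $V(H)=\operatorname{span}\{v-\pi(h)v : v\in V,\ h\in H\}$. Let $r_G^P(V)=V/V(U)$ with the induced action of $M$ (the customary twist by $\delta_P^{\pm 1/2}$ is trivial on compact subgroups and plays no role here), let $p_U\colon V\to r_G^P(V)$ be the quotient map and $p_U^K\colon V^K\to r_G^P(V)^{K\cap M}$ its restriction. An endomorphism $T$ is called stable if $\ker T=\ker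 T^2$ and $\operatorname{im}T=\operatorname{im}T^2$. Let $K\subseteq G$ be a compact open pro-$p$ subgroup in good position with respect to $\{P,\bar P\}$: the multiplication map $(K\cap U)\times(K\cap M)\times(K\cap\bar U)\to K$ is bijective, and likewise for every other ordering of the three factors. Let $\mu$ be an element of the centre of $M$ that is strictly positive with respect to $(P,M)$, that is, $$\mu(K\cap U)\mu^{-1}\subseteq K\cap U,\qquad \bigcup_{k\ge 0}\mu^{-k}(K\cap U)\mu^{k}=U,\qquad \bigcap_{k\ge0}\mu^{k}(K\cap U)\mu^{-k}=\{1\},$$ $$\mu^{-1}(K\cap\bar U)\mu\subseteq K\cap\bar U,\qquad \bigcup_{k\ge 0}\mu^{k}(K\cap\bar U)\mu^{-k}=\bar U,\qquad \bigcap_{k\ge0}\mu^{-k}(K\cap\bar U)\mu^{k}=\{1\}.$$ Let $n\ge1$ and assume that $\pi(e_{K\mu^nK})$ is stable. (1) There is a compact open subgroup $C_0\subseteq U$ such that for all compact open subgroups $C\subseteq U$ with $C\supseteq C_0$: $$\ker p_U^K=V^K\cap V(U)=V^K\cap\ker\pi(e_C)=V^K\cap\ker\pi(e_{K\mu^nK}).$$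 (2) There is a compact open subgroup $\bar C_0\subseteq\bar U$ such that for all compact open subgroups $\bar C\subseteq\bar U$ with $\bar C\supseteq\bar C_0$: $$V_*^K:=\pi(e_{K\mu^nK})V=\pi(e_K)\pi(e_{\bar C})V.$$ (3) $V^K=\ker p_U^K\oplus V_*^K$. (4) $p_U$ restricts to a bijection $V_*^K\to r_G^P(V)^{K\cap M}$. -/

import Mathlib

open scoped ValuativeRel

noncomputable section

/-! ## Linear algebraic groups, as Zariski closed subgroups of `GL_N` over an algebraic closure -/

namespace AlgGrp

variable (F : Type*) [Field F] {N : ℕ}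

/-- `GL_N(Ω)` for `Ω` the algebraic closure of `F`. -/
abbrev GLbar (F : Type*) [Field F] (N : ℕ) : Type _ :=
  Matrix.GeneralLinearGroup (Fin N) (AlgebraicClosure F)

/-- The matrix entries of `g`, as a point of affine `N²`-space. -/
def entries (g : GLbar F N) : Fin N × Fin N → AlgebraicClosure F :=
  fun ij => (g : Matrix (Fin N) (Fin N) (AlgebraicClosure F)) ij.1 ij.2

/-- The Zariski topology on `GL_N(Ω)`: the closed sets are the common zero sets of families of
polynomials in the matrix entries. -/
abbrev zariskiTopology : TopologicalSpace (GLbar F N) :=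
  TopologicalSpace.induced
    (fun g => MvPolynomial.pointToPoint (k := AlgebraicClosure F) (entries F g)) inferInstance

/-- Zariski closed subgroups of `GL_N(Ω)`, that is, linear algebraic groups over `Ω`. -/
def IsZariskiClosed (H : Subgroup (GLbar F N)) : Prop :=
  @IsClosed _ (zariskiTopology F) (H : Set (GLbar F N))

/-- Connectedness in the Zariski topology. -/
def IsZariskiConnected (H : Subgroup (GLbar F N)) : Prop :=
  @IsConnected _ (zariskiTopology F) (H : Set (GLbar F N))

/-- A linear algebraic group defined over `F`: a Zariski closed subgroup of `GL_N(Ω)` whose ideal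
is generated by polynomials with coefficients in `F`. -/
def IsDefinedOver (H : Subgroup (GLbar F N)) : Prop :=
  IsZariskiClosed F H ∧
    MvPolynomial.vanishingIdeal (AlgebraicClosure F) (entries F '' (H : Set (GLbar F N))) =
      (MvPolynomial.vanishingIdeal F (entries F '' (H : Set (GLbar F N)))).map
        (MvPolynomial.map (algebraMap F (AlgebraicClosure F)))

/-- Every element is a unipotent matrix. -/
def IsUnipotent (H : Subgroup (GLbar F N)) : Prop :=
  ∀ g ∈ H, IsNilpotent ((g : Matrix (Fin N) (Fin N) (AlgebraicClosure F)) - 1)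

/-- `U` is a Zariski closed, connected, unipotent, normal subgroup of `H`. -/
structure IsNormalUnipotent (H U : Subgroup (GLbar F N)) : Prop where
  le : U ≤ H
  normal : ∀ h ∈ H, ∀ u ∈ U, h * u * h⁻¹ ∈ U
  closed : IsZariskiClosed F U
  connected : IsZariskiConnected F U
  unipotent : IsUnipotent F U

/-- `U` is the unipotent radical of `H`: the largest Zariski closed, connected, unipotent, normal
subgroup of `H`. -/
def IsUnipotentRadical (H U : Subgroup (GLbar F N)) : Prop :=
  IsGreatest {W | IsNormalUnipotent F H W} U

/-- Connected reductive linear algebraic groups defined over `F`. -/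
structure IsConnectedReductive (H : Subgroup (GLbar F N)) : Prop where
  definedOver : IsDefinedOver F H
  connected : IsZariskiConnected F H
  reductive : IsUnipotentRadical F H ⊥

/-- `B` is a Zariski closed, connected, solvable subgroup of `H`. -/
structure IsClosedConnectedSolvable (H B : Subgroup (GLbar F N)) : Prop where
  le : B ≤ H
  closed : IsZariskiClosed F B
  connected : IsZariskiConnected F B
  solvable : Group.IsSolvable B

/-- Borel subgroups: the maximal closed connected solvable subgroups. -/
def IsBorel (H B : Subgroup (GLbar F N)) : Prop :=
  Maximal (IsClosedConnectedSolvable F H) B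

/-- `P` is a parabolic subgroup of `H` that is defined over `F`: it contains a Borel subgroup. -/
structure IsParabolic (H P : Subgroup (GLbar F N)) : Prop where
  le : P ≤ H
  definedOver : IsDefinedOver F P
  exists_borel : ∃ B, IsBorel F H B ∧ B ≤ P

/-- `M` is a Levi subgroup, defined over `F`, of the group `P` with unipotent radical `U`: a
complement of `U` in `P`. -/
structure IsLevi (P U M : Subgroup (GLbar F N)) : Prop where
  le : M ≤ P
  definedOver : IsDefinedOver F M
  inf_eq : M ⊓ U = ⊥
  sup_eq : M ⊔ U = P

/-- `P` and `Pbar` are opposite parabolic `F`-subgroups of `H` with unipotent radicals `U` and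
`Ubar` and with common Levi subgroup `M = P ∩ Pbar`. -/
structure IsOppositeParabolicPair (H P Pbar M U Ubar : Subgroup (GLbar F N)) : Prop where
  parabolic : IsParabolic F H P
  parabolic_opp : IsParabolic F H Pbar
  radical : IsUnipotentRadical F P U
  radical_opp : IsUnipotentRadical F Pbar Ubar
  levi : IsLevi F P U M
  levi_opp : IsLevi F Pbar Ubar M
  inf_eq : P ⊓ Pbar = M

/-- The group `H(F)` of `F`-rational points, inside `GL_N(F)`. -/
def rationalPoints (H : Subgroup (GLbar F N)) :
    Subgroup (Matrix.GeneralLinearGroup (Fin N) F) :=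
  H.comap (Matrix.GeneralLinearGroup.map (algebraMap F (AlgebraicClosure F)))

/-- The `F`-rational points of `L`, as a subgroup of the group `H(F)`. -/
def pointsIn (H L : Subgroup (GLbar F N)) : Subgroup (rationalPoints F H) :=
  (rationalPoints F L).subgroupOf (rationalPoints F H)

variable {F}

/-- The Levi subgroup normalises the unipotent radical, also on the level of rational points. -/
theorem IsOppositeParabolicPair.le_normalizer {H P Pbar M U Ubar : Subgroup (GLbar F N)}
    (hP : IsOppositeParabolicPair F H P Pbar M U Ubar) :
    pointsIn F H M ≤ Subgroup.normalizer (pointsIn F H U : Set (rationalPoints F H)) := by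
  intro m hm
  rw [Subgroup.mem_normalizer_iff]
  have h1 : ∀ a ∈ pointsIn F H M, ∀ u ∈ pointsIn F H U, a * u * a⁻¹ ∈ pointsIn F H U := by
    intro a ha u hu
    rw [pointsIn, Subgroup.mem_subgroupOf, rationalPoints, Subgroup.mem_comap] at ha hu ⊢
    rw [Subgroup.coe_mul, Subgroup.coe_mul, Subgroup.coe_inv, map_mul, map_mul, map_inv]
    exact hP.radical.1.normal _ (hP.levi.le ha) _ hu
  intro u
  refine ⟨h1 m hm u, fun hu => ?_⟩
  have := h1 m⁻¹ (inv_mem hm) _ hu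
  simpa [mul_assoc] using this

end AlgGrp

/-! ## Smooth representations and idempotents -/

namespace SmoothRep

variable {G : Type*} [Group G] {R : Type*} [Ring R] {V : Type*} [AddCommGroup V] [Module R V]

/-- A pro-`p` subgroup: compact and totally disconnected, with all open normal subgroups of
`p`-power index. -/
structure IsProP [TopologicalSpace G] (p : ℕ) (K : Subgroup G) : Prop where
  isCompact : IsCompact (K : Set G)
  isTotallyDisconnected : IsTotallyDisconnected (K : Set G)
  index_eq : ∀ J : Subgroup K, J.Normal → IsOpen (J : Set K) → ∃ k : ℕ, J.index = p ^ k

/-- A representation is smooth if every vector is fixed by some open subgroup. -/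
def IsSmooth [TopologicalSpace G] (π : G →* Module.End R V) : Prop :=
  ∀ v : V, ∃ J : Subgroup G, IsOpen (J : Set G) ∧ ∀ g ∈ J, π g v = v

/-- The `H`-orbit of `v`. -/
def orbitSet (π : G →* Module.End R V) (H : Subgroup G) (v : V) : Set V :=
  Set.range fun h : H => π h v

/-- The average `∫_H π(h) v dh` for the normalised Haar measure on `H`. For a compact group `H`
and a smooth vector `v`, the orbit of `v` is finite, and each of its points has the same mass. -/
def averageFun (π : G →* Module.End R V) (H : Subgroup G) (v : V) : V :=
  Ring.inverse ((orbitSet π H v).ncard : R) • ∑ᶠ w ∈ orbitSet π H v, w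

open Classical in
/-- The operator `π⟨H⟩` of integration over `H` with respect to normalised Haar measure, that is,
`v ↦ averageFun π H v`. For a smooth representation and a pro-`p` group `H`, with `p` invertible
in `R`, this map is `R`-linear, see `isLinearMap_averageFun` and `average_apply`. -/
def average (π : G →* Module.End R V) (H : Subgroup G) : V →ₗ[R] V :=
  if h : IsLinearMap R (averageFun π H) then h.mk' else 0

/-- If a finite index subgroup `S` of `H` fixes `v`, then the average over `H` is the average over
the finite set `H / S`. -/
theorem averageFun_eq (π : G →* Module.End R V) (H : Subgroup G) (v : V) (S : Subgroup H)
    [Fintype (H ⧸ S)] (hS : ∀ s ∈ S, π (s : G) v = v) (hu : IsUnit (S.index : R)) :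
    averageFun π H v =
      Ring.inverse (S.index : R) • ∑ q : H ⧸ S, π ((Quotient.out q : H) : G) v := by
  classical
  have hmk : ∀ h : H, π (((h : H ⧸ S).out : H) : G) v = π (h : G) v := by
    intro h
    obtain ⟨s, hs⟩ := QuotientGroup.mk_out_eq_mul S h
    rw [hs, Subgroup.coe_mul, map_mul, Module.End.mul_apply, hS _ s.2]
  set f : H ⧸ S → V := fun q => π ((Quotient.out q : H) : G) v with hf
  have horb : orbitSet π H v = ((Finset.univ.image f : Finset V) : Set V) := by
    ext w
    simp only [orbitSet, Set.mem_range, Finset.coe_image, Finset.coe_univ, Set.image_univ]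
    constructor
    · rintro ⟨h, rfl⟩
      exact ⟨(h : H ⧸ S), hmk h⟩
    · rintro ⟨q, rfl⟩
      exact ⟨q.out, rfl⟩
  set c : ℕ := (Finset.univ.filter fun q => f q = v).card with hc
  have hfib : ∀ w ∈ Finset.univ.image f, (Finset.univ.filter fun q => f q = w).card = c := by
    intro w hw
    obtain ⟨q, -, rfl⟩ := Finset.mem_image.1 hw
    have hsm : ∀ (h : H) (x : H ⧸ S), f (h • x) = π (h : G) (f x) := by
      intro h x
      obtain ⟨y, rfl⟩ := QuotientGroup.mk_surjective x
      change f ((h * y : H) : H ⧸ S) = π (h : G) (f (y : H ⧸ S))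
      simp only [hf, hmk, Subgroup.coe_mul, map_mul, Module.End.mul_apply]
    symm
    refine Finset.card_bij (fun x _ => q.out • x) ?_ ?_ ?_
    · intro x hx
      have hx' : f x = v := by simpa using hx
      have : f (q.out • x) = f q := by rw [hsm, hx']
      simpa using this
    · intro x _ y _ hxy
      exact MulAction.injective _ hxy
    · intro y hy
      have hy' : f y = f q := by simpa using hy
      refine ⟨(q.out)⁻¹ • y, ?_, by simp⟩
      have : f ((q.out)⁻¹ • y) = v := by
        rw [hsm, hy', hf, Subgroup.coe_inv, ← Module.End.mul_apply, ← map_mul]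
        simp
      simpa using this
  have hsum : ∑ q, f q = c • ∑ w ∈ Finset.univ.image f, w := by
    have := Finset.sum_comp (s := (Finset.univ : Finset (H ⧸ S))) (fun w : V => w) f
    rw [this, Finset.smul_sum]
    exact Finset.sum_congr rfl fun w hw => by rw [hfib w hw]
  have hcard : S.index = c * (Finset.univ.image f).card := by
    rw [Subgroup.index, Nat.card_eq_fintype_card, ← Finset.card_univ,
      Finset.card_eq_sum_card_image f, Finset.sum_congr rfl hfib]
    simp [mul_comm]
  have hav : averageFun π H v =
      Ring.inverse ((Finset.univ.image f).card : R) • ∑ w ∈ Finset.univ.image f, w := by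
    rw [averageFun, horb, Set.ncard_coe_finset, finsum_mem_coe_finset]
  set N : ℕ := (Finset.univ.image f).card
  rw [hcard, Nat.cast_mul] at hu ⊢
  have hcomm : Commute (c : R) (N : R) := Nat.cast_commute c _
  obtain ⟨hcu, hNu⟩ := hcomm.isUnit_mul_iff.1 hu
  rw [hav, hsum, Ring.mul_inverse_rev' hcomm, ← Nat.cast_smul_eq_nsmul R c, mul_smul,
    smul_smul (Ring.inverse (c : R)), Ring.inverse_mul_cancel _ hcu, one_smul]

theorem isLinearMap_averageFun [TopologicalSpace G] [IsTopologicalGroup G] {p : ℕ}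
    (hp : IsUnit (p : R)) {π : G →* Module.End R V} (hπ : IsSmooth π) {H : Subgroup G}
    (hH : IsProP p H) : IsLinearMap R (averageFun π H) := by
  have key : ∀ v w : V, ∃ S : Subgroup H, S.FiniteIndex ∧ IsUnit (S.index : R) ∧
      (∀ s ∈ S, π (s : G) v = v) ∧ ∀ s ∈ S, π (s : G) w = w := by
    intro v w
    obtain ⟨J, hJ, hJv⟩ := hπ v
    obtain ⟨L, hL, hLw⟩ := hπ w
    have : CompactSpace H := isCompact_iff_compactSpace.1 hH.isCompact
    set S : Subgroup H := (J ⊓ L).subgroupOf H with hS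
    have hSo : IsOpen (S : Set H) := (hJ.inter hL).preimage continuous_subtype_val
    have hfi : S.FiniteIndex :=
      Subgroup.finiteIndex_iff_finite_quotient.2 (Subgroup.quotient_finite_of_isOpen S hSo)
    have hcl : IsClosed (S.normalCore : Set H) :=
      S.normalCore_isClosed (Subgroup.isClosed_of_isOpen S hSo)
    have hop : IsOpen (S.normalCore : Set H) :=
      S.normalCore.isOpen_of_isClosed_of_finiteIndex hcl
    obtain ⟨k, hk⟩ := hH.index_eq S.normalCore inferInstance hop
    refine ⟨S.normalCore, inferInstance, ?_, ?_, ?_⟩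
    · rw [hk, Nat.cast_pow]
      exact hp.pow k
    · exact fun s hs => hJv _ (S.normalCore_le hs).1
    · exact fun s hs => hLw _ (S.normalCore_le hs).2
  refine ⟨fun v w => ?_, fun r v => ?_⟩
  · obtain ⟨S, hfi, hu, hv, hw⟩ := key v w
    have : Fintype (H ⧸ S) := Fintype.ofFinite _
    rw [averageFun_eq π H v S hv hu, averageFun_eq π H w S hw hu,
      averageFun_eq π H (v + w) S (fun s hs => by rw [map_add, hv s hs, hw s hs]) hu,
      ← smul_add, ← Finset.sum_add_distrib]
    simp only [map_add]
  · obtain ⟨S, hfi, hu, hv, -⟩ := key v v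
    have : Fintype (H ⧸ S) := Fintype.ofFinite _
    rw [averageFun_eq π H v S hv hu,
      averageFun_eq π H (r • v) S (fun s hs => by rw [map_smul, hv s hs]) hu]
    simp only [map_smul]
    rw [← Finset.smul_sum, smul_smul, smul_smul]
    congr 1
    obtain ⟨a, ha⟩ := hu
    have hcom : Commute (a : R) r := ha ▸ Nat.cast_commute S.index r
    rw [← ha, Ring.inverse_unit]
    exact hcom.units_inv_left

theorem average_apply [TopologicalSpace G] [IsTopologicalGroup G] {p : ℕ}
    (hp : IsUnit (p : R)) {π : G →* Module.End R V} (hπ : IsSmooth π) {H : Subgroup G}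
    (hH : IsProP p H) (v : V) : average π H v = averageFun π H v := by
  rw [average, dif_pos (isLinearMap_averageFun hp hπ hH)]
  rfl

/-- `π⟨K g K⟩ = π⟨K⟩ π(g) π⟨K⟩`. -/
def averageDouble (π : G →* Module.End R V) (K : Subgroup G) (g : G) : V →ₗ[R] V :=
  average π K ∘ₗ π g ∘ₗ average π K

/-- `T` is stable if `ker T = ker T²` and `im T = im T²`. -/
def IsStable (T : V →ₗ[R] V) : Prop :=
  LinearMap.ker T = LinearMap.ker (T ∘ₗ T) ∧ LinearMap.range T = LinearMap.range (T ∘ₗ T)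

/-- The submodule `V^H` of `H`-invariant vectors. -/
def invariants (π : G →* Module.End R V) (H : Subgroup G) : Submodule R V where
  carrier := {v | ∀ h ∈ H, π h v = v}
  zero_mem' := fun h _ => map_zero (π h)
  add_mem' := fun {v w} hv hw h hh => by rw [map_add, hv h hh, hw h hh]
  smul_mem' := fun r v hv h hh => by rw [map_smul, hv h hh]

/-- `V(U)`, the span of all `v - u v`; the quotient `V / V(U)` is the space of coinvariants. -/
def coinvKer (π : G →* Module.End R V) (U : Subgroup G) : Submodule R V :=
  Submodule.span R {x | ∃ v : V, ∃ u ∈ U, x = v - π u v}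

theorem coinvKer_le_comap (π : G →* Module.End R V) {U : Subgroup G} {m : G}
    (hm : m ∈ Subgroup.normalizer (U : Set G)) :
    coinvKer π U ≤ (coinvKer π U).comap (π m) := by
  refine Submodule.span_le.2 ?_
  rintro _ ⟨v, u, hu, rfl⟩
  refine Submodule.subset_span ⟨π m v, m * u * m⁻¹, (Subgroup.mem_normalizer_iff.1 hm u).1 hu, ?_⟩
  rw [map_sub, ← Module.End.mul_apply, ← Module.End.mul_apply, ← map_mul, ← map_mul]
  simp [mul_assoc]

/-- The representation of `M` on the `U`-coinvariant space `V / V(U)`, if `M` normalises `U`. -/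
def jacquet (π : G →* Module.End R V) (U M : Subgroup G)
    (hM : M ≤ Subgroup.normalizer (U : Set G)) : M →* Module.End R (V ⧸ coinvKer π U) where
  toFun m := (coinvKer π U).mapQ (coinvKer π U) (π m) (coinvKer_le_comap π (hM m.2))
  map_one' := by
    refine LinearMap.ext fun x => ?_
    obtain ⟨v, rfl⟩ := Submodule.Quotient.mk_surjective _ x
    simp [Submodule.mapQ_apply]
  map_mul' a b := by
    refine LinearMap.ext fun x => ?_
    obtain ⟨v, rfl⟩ := Submodule.Quotient.mk_surjective _ x
    simp [Submodule.mapQ_apply]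

/-- The quotient map `V → V / V(U)`. -/
def projU (π : G →* Module.End R V) (U : Subgroup G) : V →ₗ[R] V ⧸ coinvKer π U :=
  (coinvKer π U).mkQ

/-- The restriction `V^K → (V / V(U))^{K ∩ M}` of the quotient map. -/
def projUK (π : G →* Module.End R V) (U M K : Subgroup G)
    (hM : M ≤ Subgroup.normalizer (U : Set G)) :
    invariants π K →ₗ[R] invariants (jacquet π U M hM) (K.subgroupOf M) :=
  LinearMap.codRestrict _ (projU π U ∘ₗ (invariants π K).subtype) fun v m hm => by
    have h : π (m : G) (v : V) = v := v.2 m (Subgroup.mem_subgroupOf.1 hm)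
    change (Submodule.Quotient.mk (π (m : G) (v : V)) : V ⧸ coinvKer π U) =
      Submodule.Quotient.mk (v : V)
    rw [h]

/-- `K` is in good position: it is pro-`p` and is the product, in any order, of its intersections
with `U`, `M` and `Ubar`. -/
structure IsGoodPosition [TopologicalSpace G] (p : ℕ) (U M Ubar K : Subgroup G) : Prop where
  isProP : IsProP p K
  bijOn : ∀ σ : Equiv.Perm (Fin 3),
    Set.BijOn (fun x : Fin 3 → G => x 0 * x 1 * x 2)
      (Set.univ.pi fun i => ((K ⊓ ![U, M, Ubar] (σ i) : Subgroup G) : Set G)) (K : Set G)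

/-- Conjugation by `μ` contracts `A` to `1` and exhausts `L`: the groups `μ^k A μ^{-k}` form a
decreasing sequence for `k ≥ 0` with trivial intersection, and `⋃ μ^{-k} A μ^k = L`. -/
structure Contracts (μ : G) (A L : Subgroup G) : Prop where
  conj_mem : ∀ a ∈ A, μ * a * μ⁻¹ ∈ A
  iUnion_eq : ⋃ k : ℕ, {g | ∃ a ∈ A, g = μ⁻¹ ^ k * a * μ ^ k} = (L : Set G)
  iInter_eq : ⋂ k : ℕ, {g | ∃ a ∈ A, g = μ ^ k * a * μ⁻¹ ^ k} = ({1} : Set G)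

/-- `μ` is strictly positive with respect to `(P, M)`, where `P = M U` and `Pbar = M Ubar`
(relative to `K`): it contracts `K ∩ U`, and its inverse contracts `K ∩ Ubar`. -/
structure IsStrictlyPositive (U Ubar K : Subgroup G) (μ : G) : Prop where
  contracts : Contracts μ (K ⊓ U) U
  contracts_opp : Contracts μ⁻¹ (K ⊓ Ubar) Ubar

/-- Compact open subgroups of the (topological) group `L`, regarded as subgroups of `G`. -/
structure IsCompactOpenIn [TopologicalSpace G] (L C : Subgroup G) : Prop where
  le : C ≤ L
  isCompact : IsCompact (C : Set G)
  isOpen : IsOpen (C.subgroupOf L : Set L)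

end SmoothRep

end

/-! ## Conjugate subgroups and pro-`p` groups -/

namespace SmoothRep

section Conj

variable {G : Type*} [Group G]

/-! Write A, L, B for the intersections of K with U, M, Ubar, write e_H for averaging over H, and
put s = μ^n, T = e_K s e_K. If v is K-invariant, then s v is fixed by L and B, because s commutes
with L and expands B. So K = A L B gives T v = e_A s v = s e_{s⁻¹As} v. It follows that T^k = e_K
s^k e_K for k ≥ 1, and stability says that all these operators have the same kernel and the same
range.

Kernel: for v in V^K, T v = 0 is equivalent to the vanishing of the average of v over s^{-k} A s^k,
for any single k ≥ 1 (`averageDouble_eq_zero_iff`). These groups exhaust U, the kernels of their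
averages exhaust V(U), and every large compact C in U is squeezed between two of them. This is (1).

Range: e_K e_D = T^k s^{-k} for D = s^k B s^{-k} (`average_average_conj`), so e_K e_D has the range
of T; squeezing a general D between two such groups yields (2).

Stability also splits V^K as kernel plus range, which is (3) and the injectivity in (4).
Surjectivity is Jacquet's argument (`exists_mem_range_mkQ_eq_of_forall`): averaging over A ≤ U does
not change classes modulo V(U), and a high power of s makes any L-invariant vector B-invariant as
well. -/

/-- The conjugate `g H g⁻¹`. -/
def conj (g : G) (H : Subgroup G) : Subgroup G := H.map (MulAut.conj g).toMonoidHom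

theorem mem_conj {g x : G} {H : Subgroup G} : x ∈ conj g H ↔ g⁻¹ * x * g ∈ H := by
  constructor
  · rintro ⟨y, hy, rfl⟩
    simpa [mul_assoc] using hy
  · intro h
    exact ⟨_, h, by simp [mul_assoc]⟩

theorem mul_mem_conj {g x : G} {H : Subgroup G} (hx : x ∈ H) : g * x * g⁻¹ ∈ conj g H :=
  ⟨x, hx, rfl⟩

theorem mem_conj_iff_exists {g x : G} {H : Subgroup G} :
    x ∈ conj g H ↔ ∃ h ∈ H, x = g * h * g⁻¹ := by
  constructor
  · rintro ⟨h, hh, rfl⟩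
    exact ⟨h, hh, rfl⟩
  · rintro ⟨h, hh, rfl⟩
    exact mul_mem_conj hh

theorem conj_mono (g : G) {H H' : Subgroup G} (h : H ≤ H') : conj g H ≤ conj g H' :=
  Subgroup.map_mono h

theorem conj_conj (g g' : G) (H : Subgroup G) : conj g (conj g' H) = conj (g * g') H := by
  ext x
  simp [mem_conj, mul_assoc]

theorem conj_one (H : Subgroup G) : conj 1 H = H := by
  ext x
  simp [mem_conj]

theorem conj_inf (g : G) (H H' : Subgroup G) : conj g (H ⊓ H') = conj g H ⊓ conj g H' := by
  ext x
  simp [mem_conj]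

theorem conj_eq_self {g : G} {H : Subgroup G} (hg : g ∈ Subgroup.normalizer (H : Set G)) :
    conj g H = H := by
  ext x
  rw [mem_conj]
  simpa using (Subgroup.mem_normalizer_iff.1 (inv_mem hg) x).symm

theorem conj_eq_self_of_commute {g : G} {H : Subgroup G} (hg : ∀ h ∈ H, Commute g h) :
    conj g H = H :=
  conj_eq_self <| Subgroup.centralizer_le_normalizer _ <| by
    rw [Subgroup.mem_centralizer_iff]
    exact fun h hh => ((hg h hh).eq).symm

theorem conj_pow_antitone {g : G} {H : Subgroup G} (h : conj g H ≤ H) :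
    Antitone fun k : ℕ => conj (g ^ k) H :=
  antitone_nat_of_succ_le fun k => by
    rw [pow_succ, ← conj_conj]
    exact conj_mono _ h

theorem conj_inv_pow_monotone {g : G} {H : Subgroup G} (h : conj g H ≤ H) :
    Monotone fun k : ℕ => conj (g⁻¹ ^ k) H :=
  monotone_nat_of_le_succ fun k => by
    have := conj_mono g⁻¹ h
    rw [conj_conj, inv_mul_cancel, conj_one] at this
    rw [pow_succ, ← conj_conj]
    exact conj_mono _ this

variable [TopologicalSpace G] [IsTopologicalGroup G]

theorem isCompact_conj (g : G) {H : Subgroup G} (hH : IsCompact (H : Set G)) :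
    IsCompact (conj g H : Set G) :=
  hH.image (IsTopologicalGroup.continuous_conj g)

theorem isOpen_conj (g : G) {H : Subgroup G} (hH : IsOpen (H : Set G)) :
    IsOpen (conj g H : Set G) := by
  have : (conj g H : Set G) = (fun x => g⁻¹ * x * g) ⁻¹' H := Set.ext fun x => mem_conj
  rw [this]
  exact hH.preimage (by fun_prop)

/-- Conjugates of pro-`p` groups are pro-`p`. -/
theorem IsProP.conj {p : ℕ} {H : Subgroup G} (hH : IsProP p H) (g : G) :
    IsProP p (conj g H) where
  isCompact := isCompact_conj g hH.isCompact
  isTotallyDisconnected := by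
    refine isTotallyDisconnected_of_image (f := fun x => g⁻¹ * x * g) (by fun_prop)
      (fun x y h => by simpa using h) ?_
    convert hH.isTotallyDisconnected
    ext x
    constructor
    · rintro ⟨y, hy, rfl⟩
      exact mem_conj.1 hy
    · exact fun hx => ⟨g * x * g⁻¹, mul_mem_conj hx, by simp [mul_assoc]⟩
  index_eq J hJ hJo := by
    let e : H →* SmoothRep.conj g H :=
      ((MulAut.conj g).toMonoidHom.comp H.subtype).codRestrict _ fun h => mul_mem_conj h.2
    have he : Function.Surjective e := by
      rintro ⟨x, y, hy, rfl⟩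
      exact ⟨⟨y, hy⟩, rfl⟩
    have hc : Continuous e :=
      ((IsTopologicalGroup.continuous_conj g).comp continuous_subtype_val).subtype_mk _
    rw [← Subgroup.index_comap_of_surjective J he]
    exact hH.index_eq _ inferInstance (hJo.preimage hc)

/-- Compact subgroups of pro-`p` groups are pro-`p`. -/
theorem IsProP.of_le {p : ℕ} (hp : p.Prime) {H C : Subgroup G} (hH : IsProP p H) (h : C ≤ H)
    (hC : IsCompact (C : Set G)) : IsProP p C where
  isCompact := hC
  isTotallyDisconnected := fun t ht => hH.isTotallyDisconnected t (ht.trans h)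
  index_eq J hJ hJo := by
    have : CompactSpace H := isCompact_iff_compactSpace.1 hH.isCompact
    have : TotallyDisconnectedSpace H :=
      totallyDisconnectedSpace_subtype_iff.2 hH.isTotallyDisconnected
    obtain ⟨W, hWo, hW⟩ := isOpen_induced_iff.1 hJo
    have h1 : (1 : G) ∈ W := by
      have : (1 : C) ∈ Subtype.val ⁻¹' W := hW ▸ J.one_mem
      exact this
    obtain ⟨S, hS⟩ := ProfiniteGrp.exist_openNormalSubgroup_sub_open_nhds_of_one
      (G := H) (U := Subtype.val ⁻¹' W) (hWo.preimage continuous_subtype_val) h1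
    obtain ⟨k, hk⟩ := hH.index_eq S.toSubgroup inferInstance S.isOpen'
    -- The open subgroup of `C` contains the trace of an open normal subgroup of the profinite group
    -- `H`, so its index divides a power of `p`.
    have hle : (S.toSubgroup.comap (Subgroup.inclusion h)) ≤ J := by
      intro x hx
      have : x ∈ Subtype.val ⁻¹' W := hS hx
      rw [hW] at this
      exact this
    have hdvd : J.index ∣ p ^ k := by
      refine (Subgroup.index_dvd_of_le hle).trans ?_
      rw [Subgroup.index_comap, ← hk]
      exact Subgroup.relIndex_dvd_index_of_normal _ _
    obtain ⟨m, -, hm⟩ := (Nat.dvd_prime_pow hp).1 hdvd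
    exact ⟨m, hm⟩

end Conj

/-! ## Averages over pro-`p` groups -/

section Average

variable {G : Type*} [Group G] {R : Type*} [Ring R] {V : Type*} [AddCommGroup V] [Module R V]
  {π : G →* Module.End R V}

theorem orbitSet_apply_of_mem {H : Subgroup G} {h : G} (hh : h ∈ H) (v : V) :
    orbitSet π H (π h v) = orbitSet π H v := by
  ext w
  constructor
  · rintro ⟨x, rfl⟩
    exact ⟨x * ⟨h, hh⟩, by simp⟩
  · rintro ⟨x, rfl⟩
    refine ⟨x * ⟨h, hh⟩⁻¹, ?_⟩
    simp [← Module.End.mul_apply, ← map_mul]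

theorem image_orbitSet (g : G) (H : Subgroup G) (v : V) :
    π g '' orbitSet π H v = orbitSet π (conj g H) (π g v) := by
  ext w
  constructor
  · rintro ⟨_, ⟨x, rfl⟩, rfl⟩
    refine ⟨⟨g * x * g⁻¹, mul_mem_conj x.2⟩, ?_⟩
    simp [← Module.End.mul_apply, ← map_mul]
  · rintro ⟨⟨_, y, hy, rfl⟩, rfl⟩
    refine ⟨_, ⟨⟨y, hy⟩, rfl⟩, ?_⟩
    simp [← Module.End.mul_apply, ← map_mul]

theorem apply_injective (g : G) : Function.Injective (π g) := fun v w h => by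
  have := congrArg (π g⁻¹) h
  simpa [← Module.End.mul_apply, ← map_mul] using this

theorem apply_inv_apply (g : G) (v : V) : π g (π g⁻¹ v) = v := by
  simp [← Module.End.mul_apply, ← map_mul]

theorem apply_mul_apply (g h : G) (v : V) : π (g * h) v = π g (π h v) := by
  simp

theorem invariants_antitone {H C : Subgroup G} (h : C ≤ H) :
    invariants π H ≤ invariants π C := fun _ hv c hc => hv c (h hc)

theorem apply_mem_invariants_conj {H : Subgroup G} (g : G) {v : V} (hv : v ∈ invariants π H) :
    π g v ∈ invariants π (conj g H) := by
  rintro _ ⟨h, hh, rfl⟩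
  conv_rhs => rw [← hv h hh]
  simp [← Module.End.mul_apply, ← map_mul]

variable [TopologicalSpace G] [IsTopologicalGroup G] {p : ℕ}

/-- The orbits of a pro-`p` group on a smooth representation are finite, of invertible size. -/
theorem orbitSet_finite_and_isUnit (hp : IsUnit (p : R)) (hπ : IsSmooth π) {H : Subgroup G}
    (hH : IsProP p H) (v : V) :
    (orbitSet π H v).Finite ∧ IsUnit ((orbitSet π H v).ncard : R) := by
  -- With this action the orbit set is an orbit by definition, and its size is the index of a
  -- stabiliser.
  let : MulAction H V := MulAction.compHom V (π.comp H.subtype)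
  have horb : MulAction.orbit H v = orbitSet π H v := rfl
  obtain ⟨J, hJ, hJv⟩ := hπ v
  have : CompactSpace H := isCompact_iff_compactSpace.1 hH.isCompact
  have hso : IsOpen (MulAction.stabilizer H v : Set H) :=
    Subgroup.isOpen_mono (H₁ := J.subgroupOf H) (fun h hh => hJv _ hh)
      (hJ.preimage continuous_subtype_val)
  set S := MulAction.stabilizer H v
  have hfi : S.FiniteIndex :=
    Subgroup.finiteIndex_iff_finite_quotient.2 (Subgroup.quotient_finite_of_isOpen S hso)
  have hop : IsOpen (S.normalCore : Set H) :=
    S.normalCore.isOpen_of_isClosed_of_finiteIndex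
      (S.normalCore_isClosed (Subgroup.isClosed_of_isOpen S hso))
  obtain ⟨k, hk⟩ := hH.index_eq S.normalCore inferInstance hop
  -- Only normal open subgroups are known to have `p`-power index, hence the detour through the
  -- normal core.
  have hdvd : S.index ∣ p ^ k := hk ▸ Subgroup.index_dvd_of_le S.normalCore_le
  rw [← horb, ← MulAction.index_stabilizer]
  refine ⟨Set.finite_of_ncard_ne_zero ?_, ?_⟩
  · rw [← MulAction.index_stabilizer]
    exact hfi.index_ne_zero
  · obtain ⟨c, hc⟩ := hdvd
    have hu : IsUnit ((p ^ k : ℕ) : R) := by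
      rw [Nat.cast_pow]
      exact hp.pow k
    rw [hc, Nat.cast_mul] at hu
    exact ((Nat.cast_commute _ _).isUnit_mul_iff.1 hu).1

/-- The standing hypotheses under which averaging over `H` is well behaved. -/
structure Averageable (p : ℕ) (π : G →* Module.End R V) (H : Subgroup G) : Prop where
  isUnit : IsUnit (p : R)
  isSmooth : IsSmooth π
  isProP : IsProP p H

namespace Averageable

variable {H : Subgroup G}

theorem average_eq (hH : Averageable p π H) (v : V) :
    average π H v = Ring.inverse ((orbitSet π H v).ncard : R) • ∑ᶠ w ∈ orbitSet π H v, w :=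
  average_apply hH.isUnit hH.isSmooth hH.isProP v

/-- An `H`-invariant linear map does not see averaging over `H`. -/
theorem map_average (hH : Averageable p π H) {W : Type*} [AddCommGroup W] [Module R W]
    (f : V →ₗ[R] W) {v : V} (hf : ∀ h ∈ H, f (π h v) = f v) : f (average π H v) = f v := by
  obtain ⟨hfin, hu⟩ := orbitSet_finite_and_isUnit hH.isUnit hH.isSmooth hH.isProP v
  rw [hH.average_eq, map_smul]
  have h1 : f (∑ᶠ w ∈ orbitSet π H v, w) = ∑ᶠ w ∈ orbitSet π H v, f w :=
    f.toAddMonoidHom.map_finsum_mem (fun w => w) hfin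
  have h2 : ∑ᶠ w ∈ orbitSet π H v, f w = ∑ᶠ w ∈ orbitSet π H v, f v := by
    refine finsum_mem_congr rfl ?_
    rintro _ ⟨h, rfl⟩
    exact hf h h.2
  rw [h1, h2, finsum_mem_eq_finite_toFinset_sum _ hfin, Finset.sum_const,
    ← Set.ncard_eq_toFinset_card _ hfin, ← Nat.cast_smul_eq_nsmul R, smul_smul,
    Ring.inverse_mul_cancel _ hu, one_smul]

/-- The quotient map by `W` kills the whole orbit, so it is constant there and `map_average`
applies. -/
theorem average_mem_of_forall (hH : Averageable p π H) {W : Submodule R V} {v : V}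
    (hv : ∀ h ∈ H, π h v ∈ W) : average π H v ∈ W := by
  have h1 : v ∈ W := by simpa using hv 1 (one_mem H)
  have h2 : W.mkQ (average π H v) = W.mkQ v := hH.map_average _ fun h hh => by
    rw [Submodule.mkQ_apply, Submodule.mkQ_apply, (Submodule.Quotient.mk_eq_zero W).2 h1,
      (Submodule.Quotient.mk_eq_zero W).2 (hv h hh)]
  rw [Submodule.mkQ_apply, Submodule.mkQ_apply, (Submodule.Quotient.mk_eq_zero W).2 h1] at h2
  exact (Submodule.Quotient.mk_eq_zero W).1 h2

theorem apply_average (hH : Averageable p π H) (g : G) (v : V) :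
    π g (average π H v) = average π (conj g H) (π g v) := by
  have hH' : Averageable p π (conj g H) := ⟨hH.1, hH.2, hH.3.conj g⟩
  obtain ⟨hfin, -⟩ := orbitSet_finite_and_isUnit hH.isUnit hH.isSmooth hH.isProP v
  rw [hH.average_eq, hH'.average_eq, map_smul, ← image_orbitSet,
    Set.ncard_image_of_injective _ (apply_injective g),
    finsum_mem_image (apply_injective g).injOn]
  congr 1
  exact (π g).toAddMonoidHom.map_finsum_mem (fun w => w) hfin

theorem average_mem (hH : Averageable p π H) (v : V) : average π H v ∈ invariants π H := by
  intro h hh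
  rw [hH.apply_average, conj_eq_self (Subgroup.le_normalizer hh), hH.average_eq, hH.average_eq,
    orbitSet_apply_of_mem hh]

theorem average_of_mem (hH : Averageable p π H) {v : V} (hv : v ∈ invariants π H) :
    average π H v = v :=
  hH.map_average LinearMap.id hv

theorem average_apply_of_mem (hH : Averageable p π H) {h : G} (hh : h ∈ H) (v : V) :
    average π H (π h v) = average π H v := by
  rw [hH.average_eq, hH.average_eq, orbitSet_apply_of_mem hh]

/-- Averaging over `H` is itself a `C`-invariant linear map, so it does not see averaging over `C`.
-/
theorem average_average_of_le (hH : Averageable p π H) {C : Subgroup G} (hC : Averageable p π C)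
    (h : C ≤ H) (v : V) : average π H (average π C v) = average π H v :=
  hC.map_average _ fun _ hc => hH.average_apply_of_mem (h hc) v

/-- If `H = A B` and `B` fixes `w`, then the averages of `w` over `H` and `A` agree. -/
theorem average_eq_of_mul (hH : Averageable p π H) {A : Subgroup G} (hA : Averageable p π A)
    (hAH : A ≤ H) {w : V} (hw : ∀ h ∈ H, ∃ a ∈ A, π (a⁻¹ * h) w = w) :
    average π H w = average π A w := by
  have h : orbitSet π H w = orbitSet π A w := by
    ext x
    constructor
    · rintro ⟨h, rfl⟩
      obtain ⟨a, ha, haw⟩ := hw h h.2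
      refine ⟨⟨a, ha⟩, ?_⟩
      conv_lhs => rw [← haw]
      simp [← Module.End.mul_apply, ← map_mul]
    · rintro ⟨a, rfl⟩
      exact ⟨⟨a, hAH a.2⟩, rfl⟩
  rw [hH.average_eq, hA.average_eq, h]

/-- The projection to the `U`-coinvariants is `H`-invariant. This is how averages over subgroups of
`U` are discarded modulo V(U). -/
theorem mkQ_average (hH : Averageable p π H) {U : Subgroup G} (h : H ≤ U) (v : V) :
    (coinvKer π U).mkQ (average π H v) = (coinvKer π U).mkQ v :=
  hH.map_average _ fun x hx => by
    rw [eq_comm, ← sub_eq_zero, ← map_sub, Submodule.mkQ_apply, Submodule.Quotient.mk_eq_zero]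
    exact Submodule.subset_span ⟨v, x, h hx, rfl⟩

end Averageable

end Average

end SmoothRep

/-! ## Operators attached to positive elements -/

namespace SmoothRep

section Stable

variable {R : Type*} [Ring R] {V : Type*} [AddCommGroup V] [Module R V]

/-- Exponents start at 1 because the zeroth power is the identity. -/
theorem IsStable.ker_pow_succ {T : Module.End R V} (hT : IsStable T) (k : ℕ) :
    LinearMap.ker (T ^ (k + 1)) = LinearMap.ker T := by
  induction k with
  | zero => simp
  | succ k ih =>
    ext x
    have h1 : x ∈ LinearMap.ker (T ^ (k + 1 + 1)) ↔ T x ∈ LinearMap.ker (T ^ (k + 1)) := by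
      rw [pow_succ]
      rfl
    rw [h1, ih]
    exact (SetLike.ext_iff.1 hT.1 x).symm

theorem IsStable.range_pow_succ {T : Module.End R V} (hT : IsStable T) (k : ℕ) :
    LinearMap.range (T ^ (k + 1)) = LinearMap.range T := by
  induction k with
  | zero => simp
  | succ k ih =>
    rw [pow_succ', Module.End.mul_eq_comp, LinearMap.range_comp, ih, ← LinearMap.range_comp]
    exact hT.2.symm

/-- The kernel and the range of a stable endomorphism are disjoint. -/
theorem IsStable.disjoint_ker_range {T : V →ₗ[R] V} (hT : IsStable T) :
    Disjoint (LinearMap.ker T) (LinearMap.range T) := by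
  rw [Submodule.disjoint_def]
  rintro _ hx ⟨w, rfl⟩
  have hw : w ∈ LinearMap.ker (T ∘ₗ T) := hx
  rw [← hT.1] at hw
  exact hw

end Stable

variable {G : Type*} [Group G] {R : Type*} [Ring R] {V : Type*} [AddCommGroup V] [Module R V]
  {π : G →* Module.End R V} [TopologicalSpace G] {p : ℕ}

/-- `K = A L B` with `L` normalising `B`, together with an element `s` that commutes with `L`,
contracts `A` and expands `B`. -/
structure IsPositiveDecomposition (p : ℕ) (π : G →* Module.End R V) (K A L B : Subgroup G)
    (s : G) : Prop where
  avK : Averageable p π K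
  avA : Averageable p π A
  avL : Averageable p π L
  avB : Averageable p π B
  leA : A ≤ K
  leL : L ≤ K
  leB : B ≤ K
  exists_mul : ∀ k ∈ K, ∃ a ∈ A, ∃ l ∈ L, ∃ b ∈ B, k = a * l * b
  normalizes : L ≤ Subgroup.normalizer (B : Set G)
  commute : ∀ l ∈ L, Commute s l
  contracts : conj s A ≤ A
  expands : conj s⁻¹ B ≤ B

namespace IsPositiveDecomposition

variable {K A L B : Subgroup G} {s : G}

theorem conj_pow_le (h : IsPositiveDecomposition p π K A L B s) (k : ℕ) :
    conj (s ^ k) A ≤ A := by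
  simpa [conj_one] using conj_pow_antitone h.contracts (Nat.zero_le k)

theorem conj_pow_monotone (h : IsPositiveDecomposition p π K A L B s) :
    Monotone fun k : ℕ => conj (s ^ k) B := by
  simpa using conj_inv_pow_monotone h.expands

theorem le_conj_pow (h : IsPositiveDecomposition p π K A L B s) (k : ℕ) :
    B ≤ conj (s ^ k) B := by
  simpa [conj_one] using h.conj_pow_monotone (Nat.zero_le k)

theorem conj_pow_eq (h : IsPositiveDecomposition p π K A L B s) (k : ℕ) :
    conj (s ^ k) L = L :=
  conj_eq_self_of_commute fun l hl => (h.commute l hl).pow_left k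

theorem normalizes_conj_pow (h : IsPositiveDecomposition p π K A L B s) (k : ℕ) :
    L ≤ Subgroup.normalizer (conj (s ^ k) B : Set G) := by
  have h1 := Subgroup.map_mono (f := (MulAut.conj (s ^ k)).toMonoidHom) h.normalizes
  have h2 : L.map (MulAut.conj (s ^ k)).toMonoidHom = L := h.conj_pow_eq k
  rw [h2] at h1
  exact h1.trans (Subgroup.le_normalizer_map _)

theorem pow_apply_mem (h : IsPositiveDecomposition p π K A L B s) (k : ℕ) {v : V}
    (hv : v ∈ invariants π K) :
    π (s ^ k) v ∈ invariants π L ∧ π (s ^ k) v ∈ invariants π B := by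
  constructor
  · have := apply_mem_invariants_conj (s ^ k) (invariants_antitone h.leL hv)
    rwa [h.conj_pow_eq] at this
  · exact invariants_antitone (h.le_conj_pow k)
      (apply_mem_invariants_conj (s ^ k) (invariants_antitone h.leB hv))

/-! ### Powers of the double coset operator. -/

variable [IsTopologicalGroup G]

theorem averageable_conj {H : Subgroup G} (hH : Averageable p π H) (g : G) :
    Averageable p π (conj g H) :=
  ⟨hH.1, hH.2, hH.3.conj g⟩

/-- As K = A L B and `L`, `B` fix `w`, the orbits of `w` under `K` and `A` coincide. -/
theorem average_eq (h : IsPositiveDecomposition p π K A L B s) {w : V}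
    (hL : w ∈ invariants π L) (hB : w ∈ invariants π B) : average π K w = average π A w := by
  refine h.avK.average_eq_of_mul h.avA h.leA fun k hk => ?_
  obtain ⟨a, ha, l, hl, b, hb, rfl⟩ := h.exists_mul k hk
  refine ⟨a, ha, ?_⟩
  rw [mul_assoc, inv_mul_cancel_left, apply_mul_apply, hB b hb, hL l hl]

theorem averageDouble_apply (h : IsPositiveDecomposition p π K A L B s) (k : ℕ) (v : V) :
    averageDouble π K (s ^ k) v = average π A (π (s ^ k) (average π K v)) :=
  have := h.pow_apply_mem k (h.avK.average_mem v)
  h.average_eq this.1 this.2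

theorem averageDouble_apply_of_mem (h : IsPositiveDecomposition p π K A L B s) (k : ℕ) {v : V}
    (hv : v ∈ invariants π K) :
    averageDouble π K (s ^ k) v = π (s ^ k) (average π (conj (s⁻¹ ^ k) A) v) := by
  rw [h.averageDouble_apply, h.avK.average_of_mem hv,
    (averageable_conj h.avA _).apply_average, conj_conj]
  simp [conj_one]

theorem averageDouble_mem (h : IsPositiveDecomposition p π K A L B s) (g : G) (v : V) :
    averageDouble π K g v ∈ invariants π K :=
  h.avK.average_mem _

/-- The inner average over `K` reduces to one over `A`. Moved past s, it becomes an average over s A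
s⁻¹ ≤ `K`, which the outer average absorbs. Exponent 0 is excluded: the right side would be the
average over `K`, not the identity. -/
theorem averageDouble_pow_succ (h : IsPositiveDecomposition p π K A L B s) (k : ℕ) :
    (averageDouble π K s) ^ (k + 1) = averageDouble π K (s ^ (k + 1)) := by
  induction k with
  | zero => simp
  | succ k ih =>
    rw [pow_succ', ih]
    refine LinearMap.ext fun v => ?_
    change average π K (π s (average π K (averageDouble π K (s ^ (k + 1)) v))) =
      average π K (π (s ^ (k + 2)) (average π K v))
    rw [h.avK.average_of_mem (h.averageDouble_mem _ v), h.averageDouble_apply,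
      h.avA.apply_average, h.avK.average_average_of_le (averageable_conj h.avA s)
        (h.contracts.trans h.leA), ← apply_mul_apply, ← pow_succ']

/-! ### Kernels of stable operators. -/

theorem ker_averageDouble_pow (h : IsPositiveDecomposition p π K A L B s)
    (hT : IsStable (averageDouble π K s)) {k : ℕ} (hk : 1 ≤ k) :
    LinearMap.ker (averageDouble π K (s ^ k)) = LinearMap.ker (averageDouble π K s) := by
  obtain ⟨k, rfl⟩ := Nat.exists_eq_add_of_le' hk
  rw [← h.averageDouble_pow_succ, IsStable.ker_pow_succ hT]

theorem range_averageDouble_pow (h : IsPositiveDecomposition p π K A L B s)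
    (hT : IsStable (averageDouble π K s)) {k : ℕ} (hk : 1 ≤ k) :
    LinearMap.range (averageDouble π K (s ^ k)) = LinearMap.range (averageDouble π K s) := by
  obtain ⟨k, rfl⟩ := Nat.exists_eq_add_of_le' hk
  rw [← h.averageDouble_pow_succ, IsStable.range_pow_succ hT]

/-- Stability allows T to be replaced by its `k`-th power, which on K-invariants is averaging
followed by the injective operator s^k. Thus the vanishing of the average does not depend on `k`. -/
theorem averageDouble_eq_zero_iff (h : IsPositiveDecomposition p π K A L B s)
    (hT : IsStable (averageDouble π K s)) {k : ℕ} (hk : 1 ≤ k) {v : V}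
    (hv : v ∈ invariants π K) :
    averageDouble π K s v = 0 ↔ average π (conj (s⁻¹ ^ k) A) v = 0 := by
  rw [← LinearMap.mem_ker, ← h.ker_averageDouble_pow hT hk, LinearMap.mem_ker,
    h.averageDouble_apply_of_mem k hv]
  exact map_eq_zero_iff _ (apply_injective _)

theorem inf_ker_average (h : IsPositiveDecomposition p π K A L B s)
    (hT : IsStable (averageDouble π K s)) {C : Subgroup G} (hC : Averageable p π C)
    (h1 : conj s⁻¹ A ≤ C) {k : ℕ} (hk : 1 ≤ k) (h2 : C ≤ conj (s⁻¹ ^ k) A) :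
    invariants π K ⊓ LinearMap.ker (average π C) =
      invariants π K ⊓ LinearMap.ker (averageDouble π K s) := by
  ext v
  refine and_congr_right fun (hv : v ∈ invariants π K) => ?_
  change average π C v = 0 ↔ averageDouble π K s v = 0
  constructor
  · intro hvC
    rw [h.averageDouble_eq_zero_iff hT hk hv,
      ← (averageable_conj h.avA _).average_average_of_le hC h2, hvC, map_zero]
  · intro hv0
    rw [h.averageDouble_eq_zero_iff hT le_rfl hv, pow_one] at hv0
    rw [← hC.average_average_of_le (averageable_conj h.avA _) h1, hv0, map_zero]

/-- Jacquet's description of the kernel of the projection to the coinvariants. -/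
theorem inf_coinvKer (h : IsPositiveDecomposition p π K A L B s)
    (hT : IsStable (averageDouble π K s)) {U : Subgroup G} (hU : ∀ k : ℕ, conj (s⁻¹ ^ k) A ≤ U)
    (hU' : ∀ u ∈ U, ∃ k : ℕ, u ∈ conj (s⁻¹ ^ k) A) :
    invariants π K ⊓ coinvKer π U =
      invariants π K ⊓ LinearMap.ker (averageDouble π K s) := by
  have hmono := conj_inv_pow_monotone h.contracts
  have hup : ∀ {i j : ℕ} {x : V}, i ≤ j → average π (conj (s⁻¹ ^ i) A) x = 0 →
      average π (conj (s⁻¹ ^ j) A) x = 0 := by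
    intro i j x hij hx
    rw [← (averageable_conj h.avA _).average_average_of_le (averageable_conj h.avA _)
      (hmono hij), hx, map_zero]
  -- A generator v - u v dies as soon as the group contains u; sums are handled by monotonicity of
  -- the groups.
  have hspan : ∀ x ∈ coinvKer π U, ∃ k : ℕ, average π (conj (s⁻¹ ^ k) A) x = 0 := by
    intro x hx
    induction hx using Submodule.span_induction with
    | mem x hx =>
      obtain ⟨v, u, hu, rfl⟩ := hx
      obtain ⟨k, hk⟩ := hU' u hu
      exact ⟨k, by rw [map_sub, (averageable_conj h.avA _).average_apply_of_mem hk, sub_self]⟩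
    | zero => exact ⟨0, map_zero _⟩
    | add x y _ _ hx hy =>
      obtain ⟨i, hi⟩ := hx
      obtain ⟨j, hj⟩ := hy
      refine ⟨max i j, ?_⟩
      rw [map_add, hup (le_max_left i j) hi, hup (le_max_right i j) hj, add_zero]
    | smul r x _ hx =>
      obtain ⟨i, hi⟩ := hx
      exact ⟨i, by rw [map_smul, hi, smul_zero]⟩
  ext v
  refine and_congr_right fun (hv : v ∈ invariants π K) => ?_
  change v ∈ coinvKer π U ↔ averageDouble π K s v = 0
  constructor
  · intro hvU
    obtain ⟨k, hk⟩ := hspan v hvU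
    -- `k` may be 0, whereas the criterion needs a positive exponent.
    rw [h.averageDouble_eq_zero_iff hT (Nat.le_add_left 1 k) hv]
    exact hup (Nat.le_succ k) hk
  · intro hv0
    rw [h.averageDouble_eq_zero_iff hT le_rfl hv] at hv0
    have := (averageable_conj h.avA (s⁻¹ ^ 1)).mkQ_average (hU 1) v
    rw [hv0, map_zero] at this
    exact (Submodule.Quotient.mk_eq_zero _).1 this.symm

/-! ### Ranges of stable operators. -/

theorem average_average_mem (h : IsPositiveDecomposition p π K A L B s) {H : Subgroup G}
    (hH : Averageable p π H) (hLH : L ≤ Subgroup.normalizer (H : Set G)) (u : V) :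
    average π L (average π H u) ∈ invariants π H := by
  refine h.avL.average_mem_of_forall fun l hl => ?_
  have := apply_mem_invariants_conj l (hH.average_mem u)
  rwa [conj_eq_self (hLH hl)] at this

/-- The average over `K` absorbs averages over `L` and `B`, so both sides can be computed from the
vectors `w` and `z` = s^{-k} `w`, each fixed by `L` and `B`. Both sides then equal the average of
`w` over `A`. -/
theorem average_average_conj (h : IsPositiveDecomposition p π K A L B s) (k : ℕ) (v : V) :
    average π K (average π (conj (s ^ k) B) v) =
      averageDouble π K (s ^ k) (π (s ^ k)⁻¹ v) := by
  have avB' := averageable_conj h.avB (s ^ k)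
  set z := average π L (average π B (π (s ^ k)⁻¹ v)) with hz
  set w := average π L (average π (conj (s ^ k) B) v) with hw
  have hzw : π (s ^ k) z = w := by
    rw [hz, h.avL.apply_average, h.avB.apply_average, h.conj_pow_eq, apply_inv_apply]
  have h1 : average π K (average π (conj (s ^ k) B) v) = average π A w := by
    rw [← h.avK.average_average_of_le h.avL h.leL]
    exact h.average_eq (h.avL.average_mem _) (invariants_antitone (h.le_conj_pow k)
      (h.average_average_mem avB' (h.normalizes_conj_pow k) v))
  have h2 : average π K (π (s ^ k)⁻¹ v) = average π A z := by
    rw [← h.avK.average_average_of_le h.avB h.leB, ← h.avK.average_average_of_le h.avL h.leL]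
    exact h.average_eq (h.avL.average_mem _) (h.average_average_mem h.avB h.normalizes _)
  rw [h1, h.averageDouble_apply, h2, h.avA.apply_average, hzw,
    h.avA.average_average_of_le (averageable_conj h.avA _) (h.conj_pow_le k)]

theorem range_average_average_conj (h : IsPositiveDecomposition p π K A L B s)
    (hT : IsStable (averageDouble π K s)) {k : ℕ} (hk : 1 ≤ k) :
    LinearMap.range (average π K ∘ₗ average π (conj (s ^ k) B)) =
      LinearMap.range (averageDouble π K s) := by
  rw [← h.range_averageDouble_pow hT hk]
  apply le_antisymm
  · rintro _ ⟨v, rfl⟩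
    exact ⟨_, (h.average_average_conj k v).symm⟩
  · rintro _ ⟨v, rfl⟩
    refine ⟨π (s ^ k) v, ?_⟩
    rw [LinearMap.comp_apply, h.average_average_conj, ← apply_mul_apply, inv_mul_cancel, map_one,
      Module.End.one_apply]

theorem range_average_average (h : IsPositiveDecomposition p π K A L B s)
    (hT : IsStable (averageDouble π K s)) {D : Subgroup G} (hD : Averageable p π D)
    (h1 : conj s B ≤ D) {k : ℕ} (hk : 1 ≤ k) (h2 : D ≤ conj (s ^ k) B) :
    LinearMap.range (averageDouble π K s) =
      LinearMap.range (average π K ∘ₗ average π D) := by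
  -- Larger groups have fewer invariants, hence smaller ranges; this squeezes the range for `D`.
  have absorb : ∀ {C C' : Subgroup G}, Averageable p π C → Averageable p π C' → C ≤ C' →
      LinearMap.range (average π K ∘ₗ average π C') ≤
        LinearMap.range (average π K ∘ₗ average π C) := by
    rintro C C' hC hC' hle _ ⟨v, rfl⟩
    refine ⟨average π C' v, ?_⟩
    rw [LinearMap.comp_apply, LinearMap.comp_apply,
      hC.average_of_mem (invariants_antitone hle (hC'.average_mem v))]
  apply le_antisymm
  · rw [← h.range_average_average_conj hT hk]
    exact absorb hD (averageable_conj h.avB _) h2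
  · rw [← h.range_average_average_conj hT le_rfl, pow_one]
    exact absorb (averageable_conj h.avB _) hD h1

theorem ker_sup_range (h : IsPositiveDecomposition p π K A L B s)
    (hT : IsStable (averageDouble π K s)) :
    invariants π K ⊓ LinearMap.ker (averageDouble π K s) ⊔
      LinearMap.range (averageDouble π K s) = invariants π K := by
  have hrange : LinearMap.range (averageDouble π K s) ≤ invariants π K := by
    rintro _ ⟨w, rfl⟩
    exact h.averageDouble_mem s w
  refine le_antisymm (sup_le inf_le_left hrange) fun v hv => ?_
  have h1 : averageDouble π K s v ∈ LinearMap.range (averageDouble π K s) := ⟨v, rfl⟩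
  rw [hT.2] at h1
  -- T v = T² w, so v - T w lies in the kernel.
  obtain ⟨w, hw⟩ := h1
  refine Submodule.mem_sup.2 ⟨v - averageDouble π K s w, ⟨?_, ?_⟩, averageDouble π K s w, ⟨w, rfl⟩,
    sub_add_cancel _ _⟩
  · exact sub_mem hv (h.averageDouble_mem s w)
  · change averageDouble π K s (v - averageDouble π K s w) = 0
    rw [map_sub, ← hw, LinearMap.comp_apply, sub_self]

theorem exists_mem_range_mkQ_eq (h : IsPositiveDecomposition p π K A L B s)
    (hT : IsStable (averageDouble π K s)) {U : Subgroup G} (hU : ∀ k : ℕ, conj (s⁻¹ ^ k) A ≤ U)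
    (hU' : ∀ u ∈ U, ∃ k : ℕ, u ∈ conj (s⁻¹ ^ k) A)
    {v : V} (hv : v ∈ invariants π K) :
    ∃ t ∈ LinearMap.range (averageDouble π K s),
      (coinvKer π U).mkQ t = (coinvKer π U).mkQ v := by
  rw [← h.ker_sup_range hT, ← h.inf_coinvKer hT hU hU'] at hv
  obtain ⟨q, hq, t, ht, rfl⟩ := Submodule.mem_sup.1 hv
  refine ⟨t, ht, ?_⟩
  have : (coinvKer π U).mkQ q = 0 := (Submodule.Quotient.mk_eq_zero _).2 hq.2
  rw [map_add, this, zero_add]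

/-- The projection to the coinvariants maps the range of a stable operator onto the
`L`-invariants. -/
theorem exists_mem_range_mkQ_eq_of_forall (h : IsPositiveDecomposition p π K A L B s)
    (hT : IsStable (averageDouble π K s)) {U : Subgroup G} (hAU : A ≤ U)
    (hsU : s ∈ Subgroup.normalizer (U : Set G)) (hU : ∀ k : ℕ, conj (s⁻¹ ^ k) A ≤ U)
    (hU' : ∀ u ∈ U, ∃ k : ℕ, u ∈ conj (s⁻¹ ^ k) A)
    (hB : ∀ v : V, ∃ k : ℕ, 1 ≤ k ∧ v ∈ invariants π (conj (s⁻¹ ^ k) B))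
    {v : V} (hv : ∀ l ∈ L, (coinvKer π U).mkQ (π l v) = (coinvKer π U).mkQ v) :
    ∃ t ∈ LinearMap.range (averageDouble π K s),
      (coinvKer π U).mkQ t = (coinvKer π U).mkQ v := by
  -- After translation by s^k the averaged vector is fixed by both `L` and `B`, so averaging it over
  -- `K` amounts to averaging over `A` and keeps its class.
  obtain ⟨k, hk1, hk⟩ := hB (average π L v)
  have hsk : s⁻¹ ^ k ∈ Subgroup.normalizer (U : Set G) := pow_mem (inv_mem hsU) k
  have hL : π (s ^ k) (average π L v) ∈ invariants π L := by
    have := apply_mem_invariants_conj (s ^ k) (h.avL.average_mem v)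
    rwa [h.conj_pow_eq] at this
  have hB' : π (s ^ k) (average π L v) ∈ invariants π B := by
    have := apply_mem_invariants_conj (s ^ k) hk
    rwa [conj_conj, inv_pow, mul_inv_cancel, conj_one] at this
  obtain ⟨t, ht, htv⟩ := h.exists_mem_range_mkQ_eq hT hU hU'
    (h.avK.average_mem (π (s ^ k) (average π L v)))
  rw [h.average_eq hL hB', h.avA.mkQ_average hAU] at htv
  -- The range is rewritten with the same exponent `k`, so that s^k appears on both sides of the
  -- congruence and can be cancelled.
  rw [← h.range_averageDouble_pow hT hk1] at ht
  obtain ⟨x, rfl⟩ := ht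
  rw [h.averageDouble_apply, h.avA.mkQ_average hAU, ← sub_eq_zero, ← map_sub, ← map_sub] at htv
  have h1 := coinvKer_le_comap π hsk ((Submodule.Quotient.mk_eq_zero _).1 htv)
  rw [Submodule.mem_comap, ← apply_mul_apply, inv_pow, inv_mul_cancel, map_one,
    Module.End.one_apply] at h1
  have h2 : (coinvKer π U).mkQ (average π K x) = (coinvKer π U).mkQ v := by
    -- The class of `v` is `L`-invariant, so averaging over `L` did not change it.
    rw [← h.avL.map_average _ hv, ← sub_eq_zero, ← map_sub]
    exact (Submodule.Quotient.mk_eq_zero _).2 h1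
  rw [← h2]
  exact h.exists_mem_range_mkQ_eq hT hU hU' (h.avK.average_mem x)

end IsPositiveDecomposition

end SmoothRep

namespace SmoothRep

/-! ## Contracting elements -/

section Contracts

variable {G : Type*} [Group G]

namespace Contracts

variable {μ : G} {A L : Subgroup G}

theorem conj_le (h : Contracts μ A L) : conj μ A ≤ A := by
  rintro _ ⟨a, ha, rfl⟩
  exact h.conj_mem a ha

theorem mem_iff (h : Contracts μ A L) {x : G} : x ∈ L ↔ ∃ k : ℕ, x ∈ conj (μ⁻¹ ^ k) A := by
  rw [← SetLike.mem_coe, ← h.iUnion_eq, Set.mem_iUnion]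
  refine exists_congr fun k => ?_
  rw [mem_conj_iff_exists, inv_pow, inv_inv]
  rfl

theorem conj_inv_pow_le (h : Contracts μ A L) (k : ℕ) : conj (μ⁻¹ ^ k) A ≤ L :=
  fun _ hx => h.mem_iff.2 ⟨k, hx⟩

variable [TopologicalSpace G] [IsTopologicalGroup G]

/-- Every compact subgroup of `L` is contained in all large conjugates of `A = K ∩ L`. -/
theorem exists_forall_le {K : Subgroup G} (hK : IsOpen (K : Set G))
    (h : Contracts μ (K ⊓ L) L) (hμ : μ ∈ Subgroup.normalizer (L : Set G)) {C : Subgroup G}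
    (hC : IsCompact (C : Set G)) (hCL : C ≤ L) :
    ∃ k₀ : ℕ, ∀ k, k₀ ≤ k → C ≤ conj (μ⁻¹ ^ k) (K ⊓ L) := by
  -- Conjugates of `K` are used because K ∩ L need not be open in G; intersecting with the
  -- normalised group `L` recovers its conjugates.
  have hcov : (C : Set G) ⊆ ⋃ k : ℕ, (conj (μ⁻¹ ^ k) K : Set G) := by
    intro x hx
    obtain ⟨k, hk⟩ := h.mem_iff.1 (hCL hx)
    exact Set.mem_iUnion.2 ⟨k, conj_mono _ inf_le_left hk⟩
  obtain ⟨t, ht⟩ := hC.elim_finite_subcover _ (fun k => isOpen_conj _ hK) hcov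
  refine ⟨t.sup id, fun k hk x hx => ?_⟩
  obtain ⟨i, hi, hxi⟩ := Set.mem_iUnion₂.1 (ht hx)
  have hxi' : x ∈ conj (μ⁻¹ ^ i) (K ⊓ L) := by
    rw [conj_inf, conj_eq_self (pow_mem (inv_mem hμ) i)]
    exact ⟨hxi, hCL hx⟩
  exact conj_inv_pow_monotone h.conj_le ((Finset.le_sup (f := id) hi).trans hk) hxi'

/-- The conjugates of the compact group `A` shrink to the identity. -/
theorem exists_forall_subset [T2Space G] (h : Contracts μ A L) (hA : IsCompact (A : Set G))
    {J : Subgroup G} (hJ : IsOpen (J : Set G)) :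
    ∃ k₀ : ℕ, ∀ k, k₀ ≤ k → conj (μ ^ k) A ≤ J := by
  have hanti := conj_pow_antitone h.conj_le
  have hdir : Directed (fun x1 x2 : Set G => x1 ⊇ x2)
      fun k : ℕ => (conj (μ ^ k) A : Set G) := fun i j =>
    ⟨max i j, hanti (le_max_left i j), hanti (le_max_right i j)⟩
  -- A decreasing family of compact sets with intersection {1} eventually enters the neighbourhood
  -- `J` of 1.
  obtain ⟨k₀, hk₀⟩ := exists_subset_nhds_of_isCompact' (U := (J : Set G)) hdir
    (fun k => isCompact_conj _ hA) (fun k => (isCompact_conj _ hA).isClosed) <| by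
      intro x hx
      have : x ∈ ({1} : Set G) := by
        rw [← h.iInter_eq, Set.mem_iInter]
        intro k
        have hxk : x ∈ conj (μ ^ k) A := Set.mem_iInter.1 hx k
        rw [mem_conj_iff_exists, ← inv_pow] at hxk
        exact hxk
      rw [Set.mem_singleton_iff.1 this]
      exact hJ.mem_nhds (one_mem J)
  exact ⟨k₀, fun k hk x hx => hk₀ (hanti hk hx)⟩

end Contracts

theorem isCompactOpenIn_conj [TopologicalSpace G] [IsTopologicalGroup G] {K L : Subgroup G} (hK : IsOpen (K : Set G))
    (hc : IsCompact ((K ⊓ L : Subgroup G) : Set G)) {g : G}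
    (hg : g ∈ Subgroup.normalizer (L : Set G)) : IsCompactOpenIn L (conj g (K ⊓ L)) where
  le := by
    rw [conj_inf, conj_eq_self hg]
    exact inf_le_right
  isCompact := isCompact_conj g hc
  isOpen := by
    rw [conj_inf, conj_eq_self hg, Subgroup.inf_subgroupOf_right]
    exact (isOpen_conj g hK).preimage continuous_subtype_val

end Contracts

/-! ## The decomposition of the invariants -/

theorem bijOn_projU_and_decomposition {G : Type*} [Group G] [TopologicalSpace G]
    [IsTopologicalGroup G] [T2Space G] {p : ℕ} (hprime : p.Prime) {R : Type*} [Ring R]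
    (hp : IsUnit (p : R)) {V : Type*} [AddCommGroup V] [Module R V]
    (π : G →* Module.End R V) (hπ : IsSmooth π) {U L Ubar K : Subgroup G}
    (hUc : IsClosed (U : Set G)) (hLc : IsClosed (L : Set G)) (hUbarc : IsClosed (Ubar : Set G))
    (hL : L ≤ Subgroup.normalizer (U : Set G)) (hL' : L ≤ Subgroup.normalizer (Ubar : Set G))
    (hKopen : IsOpen (K : Set G)) (hK : IsGoodPosition p U L Ubar K)
    {μ : G} (hμL : μ ∈ L) (hμ : ∀ l ∈ L, Commute μ l)
    (hpos : IsStrictlyPositive U Ubar K μ) {n : ℕ} (hn : 1 ≤ n)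
    (hstable : IsStable (averageDouble π K (μ ^ n))) :
    let T : V →ₗ[R] V := averageDouble π K (μ ^ n)
    let VK : Submodule R V := invariants π K
    let kerpUK : Submodule R V := (LinearMap.ker (projUK π U L K hL)).map VK.subtype
    let VKstar : Submodule R V := LinearMap.range T
    (∃ C₀ : Subgroup G, IsCompactOpenIn U C₀ ∧
      ∀ C : Subgroup G, IsCompactOpenIn U C → C₀ ≤ C →
        kerpUK = VK ⊓ coinvKer π U ∧
        VK ⊓ coinvKer π U = VK ⊓ LinearMap.ker (average π C) ∧
        VK ⊓ LinearMap.ker (average π C) = VK ⊓ LinearMap.ker T) ∧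
    (∃ D₀ : Subgroup G, IsCompactOpenIn Ubar D₀ ∧
      ∀ D : Subgroup G, IsCompactOpenIn Ubar D → D₀ ≤ D →
        VKstar = LinearMap.range (average π K ∘ₗ average π D)) ∧
    (Disjoint kerpUK VKstar ∧ kerpUK ⊔ VKstar = VK) ∧
    Set.BijOn (projU π U) (VKstar : Set V)
      (invariants (jacquet π U L hL) (K.subgroupOf L) : Set (V ⧸ coinvKer π U)) := by
  intro T VK kerpUK VKstar
  have hKc : IsCompact (K : Set G) := hK.isProP.isCompact
  have avK : Averageable p π K := ⟨hp, hπ, hK.isProP⟩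
  have av_inf : ∀ {H : Subgroup G}, IsClosed (H : Set G) → Averageable p π (K ⊓ H) := fun hH =>
    ⟨hp, hπ, hK.isProP.of_le hprime inf_le_left (hKc.inter_right hH)⟩
  have avA := av_inf hUc
  have avB := av_inf hUbarc
  have hA := hpos.contracts
  have hB := hpos.contracts_opp
  have hμU := hL hμL
  have hμUbar := hL' hμL
  set s := μ ^ n with hs
  have hspow : ∀ k : ℕ, s⁻¹ ^ k = μ⁻¹ ^ (n * k) := fun k => by rw [hs, ← inv_pow, pow_mul]
  -- Powers of s are only every `n`-th power of `μ`; by monotonicity this subsequence suffices.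
  have hle : ∀ k : ℕ, k ≤ n * k := fun k => Nat.le_mul_of_pos_left k hn
  have h : IsPositiveDecomposition p π K (K ⊓ U) (K ⊓ L) (K ⊓ Ubar) s :=
    { avK := avK
      avA := avA
      avL := av_inf hLc
      avB := avB
      leA := inf_le_left
      leL := inf_le_left
      leB := inf_le_left
      exists_mul := by
        intro k hk
        -- The identity permutation gives the order U, M, Ubar.
        obtain ⟨x, hx, rfl⟩ := (hK.bijOn 1).surjOn hk
        exact ⟨x 0, hx 0 trivial, x 1, hx 1 trivial, x 2, hx 2 trivial, rfl⟩
      normalizes := fun l hl => Subgroup.inf_normalizer_le_normalizer_inf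
        ⟨Subgroup.le_normalizer hl.1, hL' hl.2⟩
      commute := fun l hl => (hμ l hl.2).pow_left n
      contracts := by
        simpa [conj_one] using conj_pow_antitone hA.conj_le (Nat.zero_le n)
      expands := by
        have := conj_pow_antitone hB.conj_le (Nat.zero_le n)
        simpa [conj_one, hs] using this }
  have hU : ∀ k : ℕ, conj (s⁻¹ ^ k) (K ⊓ U) ≤ U := fun k => by
    rw [hspow]
    exact hA.conj_inv_pow_le _
  have hexU : ∀ C : Subgroup G, IsCompact (C : Set G) → C ≤ U →
      ∃ k : ℕ, 1 ≤ k ∧ C ≤ conj (s⁻¹ ^ k) (K ⊓ U) := by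
    intro C hC hCU
    obtain ⟨k, hk⟩ := hA.exists_forall_le hKopen hμU hC hCU
    refine ⟨k + 1, Nat.le_add_left 1 k, ?_⟩
    rw [hspow]
    exact hk _ ((Nat.le_succ k).trans (hle _))
  have hU' : ∀ u ∈ U, ∃ k : ℕ, u ∈ conj (s⁻¹ ^ k) (K ⊓ U) := by
    intro u hu
    obtain ⟨k, hk⟩ := hA.mem_iff.1 hu
    refine ⟨k, ?_⟩
    rw [hspow]
    exact conj_inv_pow_monotone hA.conj_le (hle k) hk
  have hexUbar : ∀ D : Subgroup G, IsCompact (D : Set G) → D ≤ Ubar →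
      ∃ k : ℕ, 1 ≤ k ∧ D ≤ conj (s ^ k) (K ⊓ Ubar) := by
    intro D hD hDU
    obtain ⟨k, hk⟩ := hB.exists_forall_le hKopen (inv_mem hμUbar) hD hDU
    refine ⟨k + 1, Nat.le_add_left 1 k, ?_⟩
    have := hk (n * (k + 1)) ((Nat.le_succ k).trans (hle _))
    rwa [inv_inv, pow_mul] at this
  -- By smoothness `v` is fixed by an open subgroup, into which the conjugates of K ∩ Ubar shrink.
  have hshrink : ∀ v : V, ∃ k : ℕ, 1 ≤ k ∧ v ∈ invariants π (conj (s⁻¹ ^ k) (K ⊓ Ubar)) := by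
    intro v
    obtain ⟨J, hJ, hJv⟩ := hπ v
    obtain ⟨k, hk⟩ := hB.exists_forall_subset avB.isProP.isCompact hJ
    refine ⟨k + 1, Nat.le_add_left 1 k, fun g hg => hJv g ?_⟩
    rw [hspow] at hg
    exact hk _ ((Nat.le_succ k).trans (hle _)) hg
  have hker : kerpUK = VK ⊓ coinvKer π U := by
    ext v
    constructor
    · rintro ⟨w, hw, rfl⟩
      exact ⟨w.2, (Submodule.Quotient.mk_eq_zero _).1 (congrArg Subtype.val hw)⟩
    · rintro ⟨hv, hvU⟩
      exact ⟨⟨v, hv⟩, Subtype.ext ((Submodule.Quotient.mk_eq_zero _).2 hvU), rfl⟩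
  have hcoinv : VK ⊓ coinvKer π U = VK ⊓ LinearMap.ker T := h.inf_coinvKer hstable hU hU'
  have hdisj : Disjoint kerpUK VKstar := by
    rw [hker, hcoinv]
    exact hstable.disjoint_ker_range.mono_left inf_le_right
  have hsup : kerpUK ⊔ VKstar = VK := by
    rw [hker, hcoinv]
    exact h.ker_sup_range hstable
  have hstar : VKstar ≤ VK := hsup ▸ le_sup_right
  refine ⟨⟨conj s⁻¹ (K ⊓ U), ?_, ?_⟩, ⟨conj s (K ⊓ Ubar), ?_, ?_⟩, ⟨hdisj, hsup⟩, ?_, ?_, ?_⟩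
  · exact isCompactOpenIn_conj hKopen avA.isProP.isCompact (inv_mem (pow_mem hμU n))
  · intro C hC hC₀
    obtain ⟨k, hk1, hk⟩ := hexU C hC.isCompact hC.le
    have hk' := h.inf_ker_average hstable
      ⟨hp, hπ, (avA.isProP.conj _).of_le hprime hk hC.isCompact⟩ hC₀ hk1 hk
    exact ⟨hker, hcoinv.trans hk'.symm, hk'⟩
  · exact isCompactOpenIn_conj hKopen avB.isProP.isCompact (pow_mem hμUbar n)
  · intro D hD hD₀
    obtain ⟨k, hk1, hk⟩ := hexUbar D hD.isCompact hD.le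
    exact h.range_average_average hstable
      ⟨hp, hπ, (avB.isProP.conj _).of_le hprime hk hD.isCompact⟩ hD₀ hk1 hk
  · intro v hv
    exact (projUK π U L K hL ⟨v, hstar hv⟩).2
  · intro v hv w hw hvw
    have h1 : v - w ∈ kerpUK := by
      rw [hker]
      exact ⟨sub_mem (hstar hv) (hstar hw), (Submodule.Quotient.eq _).1 hvw⟩
    exact sub_eq_zero.1 (Submodule.disjoint_def.1 hdisj _ h1 (sub_mem hv hw))
  · intro y hy
    obtain ⟨v, rfl⟩ := Submodule.Quotient.mk_surjective _ y
    obtain ⟨t, ht, htv⟩ := h.exists_mem_range_mkQ_eq_of_forall hstable inf_le_right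
      (pow_mem hμU n) hU hU' hshrink (v := v)
      fun l hl => hy ⟨l, hl.2⟩ (Subgroup.mem_subgroupOf.2 hl.1)
    exact ⟨t, ht, htv⟩

end SmoothRep

/-! ## Closed subgroups of the group of rational points -/

namespace AlgGrp

theorem t2Space_of_isNonarchimedeanLocalField (F : Type*) [Field F] [ValuativeRel F]
    [TopologicalSpace F] [IsNonarchimedeanLocalField F] : T2Space F := by
  let := IsTopologicalAddGroup.rightUniformSpace F
  have := isUniformAddGroup_of_addCommGroup (G := F)
  infer_instance

theorem IsOppositeParabolicPair.symm {F : Type*} [Field F] {N : ℕ}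
    {H P Pbar M U Ubar : Subgroup (GLbar F N)}
    (hP : IsOppositeParabolicPair F H P Pbar M U Ubar) :
    IsOppositeParabolicPair F H Pbar P M Ubar U :=
  ⟨hP.parabolic_opp, hP.parabolic, hP.radical_opp, hP.radical, hP.levi_opp, hP.levi,
    inf_comm Pbar P ▸ hP.inf_eq⟩

variable {F : Type*} [Field F] [TopologicalSpace F] [IsTopologicalRing F] [T2Space F] {N : ℕ}

/-- The zero set in `F^σ` of a polynomial over an extension field of `F` is closed. -/
theorem isClosed_zeros {E : Type*} [Field E] [Algebra F E] {σ : Type*} (f : MvPolynomial σ E) :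
    IsClosed {x : σ → F | MvPolynomial.eval (fun i => algebraMap F E (x i)) f = 0} := by
  -- `F`-linear functionals separate the points of `E`. Applied to the coefficients of `f`, they
  -- give polynomials over `F` with the same common zeros in F^σ, so no topology on `E` is needed.
  have h : {x : σ → F | MvPolynomial.eval (fun i => algebraMap F E (x i)) f = 0} =
      ⋂ φ : Module.Dual F E, {x | ∑ m ∈ f.support, φ (f.coeff m) * m.prod (fun i k => x i ^ k) =
        0} := by
    ext x
    rw [Set.mem_iInter, Set.mem_ofPred_eq, ← Module.forall_dual_apply_eq_zero_iff F]
    refine forall_congr' fun φ => ?_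
    rw [Set.mem_ofPred_eq, MvPolynomial.eval_eq, map_sum]
    refine Eq.congr (Finset.sum_congr rfl fun m _ => ?_) rfl
    have : f.coeff m * ∏ i ∈ m.support, algebraMap F E (x i) ^ m i =
        m.prod (fun i k => x i ^ k) • f.coeff m := by
      rw [Algebra.smul_def, mul_comm, Finsupp.prod, map_prod]
      simp only [map_pow]
    rw [this, map_smul, smul_eq_mul, mul_comm]
  rw [h]
  refine isClosed_iInter fun φ => isClosed_eq ?_ continuous_const
  unfold Finsupp.prod
  fun_prop

theorem isClosed_rationalPoints {H : Subgroup (GLbar F N)} (hH : IsZariskiClosed F H) :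
    IsClosed (rationalPoints F H : Set (Matrix.GeneralLinearGroup (Fin N) F)) := by
  obtain ⟨Z, hZ, hZH⟩ := isClosed_induced_iff.1 hH
  obtain ⟨S, rfl⟩ := (PrimeSpectrum.isClosed_iff_zeroLocus _).1 hZ
  have h : (rationalPoints F H : Set (Matrix.GeneralLinearGroup (Fin N) F)) =
      ⋂ f ∈ S, (fun (g : Matrix.GeneralLinearGroup (Fin N) F) (ij : Fin N × Fin N) =>
        (g : Matrix (Fin N) (Fin N) F) ij.1 ij.2) ⁻¹'
          {x | MvPolynomial.eval (fun i => algebraMap F (AlgebraicClosure F) (x i)) f = 0} := by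
    ext g
    have h1 : g ∈ rationalPoints F H ↔ Matrix.GeneralLinearGroup.map
        (algebraMap F (AlgebraicClosure F)) g ∈ (H : Set (GLbar F N)) := Iff.rfl
    rw [SetLike.mem_coe, h1, ← hZH, Set.mem_preimage, PrimeSpectrum.mem_zeroLocus, Set.mem_iInter₂]
    refine forall₂_congr fun f _ => ?_
    exact MvPolynomial.mem_vanishingIdeal_singleton_iff _ _
  rw [h]
  refine isClosed_biInter fun f _ => (isClosed_zeros f).preimage ?_
  exact continuous_pi fun ij => Units.continuous_val.matrix_elem _ _

theorem isClosed_pointsIn {H L : Subgroup (GLbar F N)} (hL : IsZariskiClosed F L) :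
    IsClosed (pointsIn F H L : Set (rationalPoints F H)) :=
  (isClosed_rationalPoints hL).preimage continuous_subtype_val

end AlgGrp

theorem mainTheorem3
    {F : Type*} [Field F] [ValuativeRel F] [TopologicalSpace F] [IsNonarchimedeanLocalField F]
    (p : ℕ) [CharP 𝓀[F] p]
    {N : ℕ} (𝒢 P Pbar M 𝒰 𝒰bar : Subgroup (AlgGrp.GLbar F N))
    (h𝒢 : AlgGrp.IsConnectedReductive F 𝒢)
    (hP : AlgGrp.IsOppositeParabolicPair F 𝒢 P Pbar M 𝒰 𝒰bar)
    {R : Type*} [Ring R] (hp : IsUnit (p : R))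
    {V : Type*} [AddCommGroup V] [Module R V]
    (π : AlgGrp.rationalPoints F 𝒢 →* Module.End R V) (hπ : SmoothRep.IsSmooth π)
    (K : Subgroup (AlgGrp.rationalPoints F 𝒢))
    (hKopen : IsOpen (K : Set (AlgGrp.rationalPoints F 𝒢)))
    (hK : SmoothRep.IsGoodPosition p (AlgGrp.pointsIn F 𝒢 𝒰) (AlgGrp.pointsIn F 𝒢 M)
      (AlgGrp.pointsIn F 𝒢 𝒰bar) K)
    (μ : AlgGrp.pointsIn F 𝒢 M) (hμ : μ ∈ Subgroup.center (AlgGrp.pointsIn F 𝒢 M))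
    (hpos : SmoothRep.IsStrictlyPositive (AlgGrp.pointsIn F 𝒢 𝒰)
      (AlgGrp.pointsIn F 𝒢 𝒰bar) K (μ : AlgGrp.rationalPoints F 𝒢))
    (n : ℕ) (hn : 1 ≤ n)
    (hstable : SmoothRep.IsStable
      (SmoothRep.averageDouble π K ((μ : AlgGrp.rationalPoints F 𝒢) ^ n))) :
    let G := AlgGrp.rationalPoints F 𝒢
    let U : Subgroup G := AlgGrp.pointsIn F 𝒢 𝒰
    let Ubar : Subgroup G := AlgGrp.pointsIn F 𝒢 𝒰bar
    let L : Subgroup G := AlgGrp.pointsIn F 𝒢 M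
    let hL : L ≤ Subgroup.normalizer (U : Set G) := hP.le_normalizer
    let T : V →ₗ[R] V := SmoothRep.averageDouble π K ((μ : G) ^ n)
    let VK : Submodule R V := SmoothRep.invariants π K
    let kerpUK : Submodule R V :=
      (LinearMap.ker (SmoothRep.projUK π U L K hL)).map VK.subtype
    let VKstar : Submodule R V := LinearMap.range T
    (∃ C₀ : Subgroup G, SmoothRep.IsCompactOpenIn U C₀ ∧
      ∀ C : Subgroup G, SmoothRep.IsCompactOpenIn U C → C₀ ≤ C →
        kerpUK = VK ⊓ SmoothRep.coinvKer π U ∧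
        VK ⊓ SmoothRep.coinvKer π U = VK ⊓ LinearMap.ker (SmoothRep.average π C) ∧
        VK ⊓ LinearMap.ker (SmoothRep.average π C) = VK ⊓ LinearMap.ker T) ∧
    (∃ D₀ : Subgroup G, SmoothRep.IsCompactOpenIn Ubar D₀ ∧
      ∀ D : Subgroup G, SmoothRep.IsCompactOpenIn Ubar D → D₀ ≤ D →
        VKstar = LinearMap.range (SmoothRep.average π K ∘ₗ SmoothRep.average π D)) ∧
    (Disjoint kerpUK VKstar ∧ kerpUK ⊔ VKstar = VK) ∧
    Set.BijOn (SmoothRep.projU π U) (VKstar : Set V)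
      (SmoothRep.invariants (SmoothRep.jacquet π U L hL) (K.subgroupOf L) :
        Set (V ⧸ SmoothRep.coinvKer π U)) := by
  have := AlgGrp.t2Space_of_isNonarchimedeanLocalField F
  exact SmoothRep.bijOn_projU_and_decomposition (CharP.char_is_prime 𝓀[F] p) hp π hπ
    (AlgGrp.isClosed_pointsIn hP.radical.1.closed)
    (AlgGrp.isClosed_pointsIn hP.levi.definedOver.1)
    (AlgGrp.isClosed_pointsIn hP.radical_opp.1.closed)
    hP.le_normalizer hP.symm.le_normalizer hKopen hK μ.2
    (fun l hl => congrArg Subtype.val (Subgroup.mem_center_iff.1 hμ ⟨l, hl⟩).symm)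
    hpos hn hstable
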